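/- Let $\mathbb{Z}^2_{\mathrm{even}}=\{(x,t)\in\mathbb{Z}^2 : x+t \text{ is even}\}$. The dynamical discrete web is defined as follows. Each site $z\in\mathbb{Z}^2_{\mathrm{even}}$ carries a rate one Poisson clock, running in the dynamical time $\tau\ge 0$, and a sequence of fair $\pm1$-valued random variables $\eta_{z,0},\eta_{z,1},\eta_{z,2},\dots$; all the clocks and all these variables are independent. Let $\xi_z^{\tau}=\eta_{z,n}$, where $n$ is the number of rings of the clock at $z$ up to dynamical time $\tau$ (so that each ring replaces the arrow at $z$ by a new, independent one, which may agree with the old one). At dynamical time $\tau$, an arrow is drawn from each site $(x,t)\in\mathbb{Z}^2_{\mathrm{even}}$ to $(x+\xi^{\tau}_{(x,t)},\,t+1)$, and $S_0^{\tau}(t)$, $t\ge 0$, denotes the space coordinate at path time $t$ of the path that starts at $(0,0)$ and follows these arrows (linearly interpolated between integer times). Then there is a constant $C_0>0$ such that for every $C\ge C_0$ $$\mathbb{P}\left(\exists\, \tau\in[0,1] \text{ such that } \limsup_{t\to\infty}\frac{S_0^{\tau}(t)}{\sqrt{t\log t}}\ge C\right)=0 .$$ -/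

import Mathlib

open MeasureTheory ProbabilityTheory Filter
open scoped NNReal ENNReal Topology

namespace DyDW

/-- The even space-time lattice `{(x, t) ∈ ℤ² : x + t is even}`; the first coordinate is space, the
second one is path time. -/
abbrev EvenSite : Type := {z : ℤ × ℤ // Even (z.1 + z.2)}

/-- The space-time origin `(0, 0)`. -/
def origin : EvenSite := ⟨(0, 0), by simp⟩

/-- An arrow is a `Bool`: `true` points right (`+1`), `false` points left (`-1`). -/
def arrowSign (b : Bool) : ℤ := if b then 1 else -1

/-- The head `(x ± 1, t + 1)` of the arrow with tail `z = (x, t)` and direction `b`. -/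
def arrowHead (b : Bool) (z : EvenSite) : EvenSite :=
  ⟨(z.1.1 + arrowSign b, z.1.2 + 1), by
    obtain ⟨⟨x, t⟩, k, hk⟩ := z
    cases b
    · exact ⟨k, by simp only [arrowSign] at hk ⊢; norm_num; omega⟩
    · exact ⟨k + 1, by simp only [arrowSign] at hk ⊢; norm_num; omega⟩⟩

/-- The site reached from `z` after following `n` arrows of the arrow configuration `ξ`. -/
def siteAfter (ξ : EvenSite → Bool) (z : EvenSite) : ℕ → EvenSite
  | 0 => z
  | n + 1 => arrowHead (ξ (siteAfter ξ z n)) (siteAfter ξ z n)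

/-- The path `S_z` of the discrete web with arrow configuration `ξ`: the space coordinate, at the
real path time `t` (at least the time coordinate of `z`), of the path that starts at `z` and
follows the arrows, each arrow being traversed at constant speed in one unit of path time. -/
noncomputable def webPath (ξ : EvenSite → Bool) (z : EvenSite) (t : ℝ) : ℝ :=
  let n : ℕ := ⌊t - (z.1.2 : ℝ)⌋₊
  ((siteAfter ξ z n).1.1 : ℝ) +
    (t - (z.1.2 : ℝ) - (n : ℝ)) * (arrowSign (ξ (siteAfter ξ z n)) : ℝ)

variable {Ω : Type*} [MeasurableSpace Ω]

/-- `N` is (the counting process of) a rate one Poisson process on `[0, ∞)`: it starts at `0`, has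
independent increments, the number of rings in `(s, t]` is Poisson with mean `t - s`, and almost
all of its paths are non-decreasing and right-continuous. -/
structure IsUnitPoissonProcess (N : ℝ≥0 → Ω → ℕ) (μ : Measure Ω) : Prop where
  measurable : ∀ t, Measurable (N t)
  zero : ∀ᵐ ω ∂μ, N 0 ω = 0
  indepIncrements : HasIndepIncrements N μ
  law_increment : ∀ s t : ℝ≥0, s ≤ t → HasLaw (fun ω => N t ω - N s ω) (poissonMeasure (t - s)) μ
  monotone : ∀ᵐ ω ∂μ, Monotone fun t => N t ω
  rightContinuous : ∀ᵐ ω ∂μ, ∀ t, ContinuousWithinAt (fun s => N s ω) (Set.Ici t) t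

/-- The randomness that drives the dynamical discrete web. `N z τ` is the number of rings of the
clock at `z` during `(0, τ]`; `η z 0` is the initial arrow at `z` and `η z n` is the new arrow put
at `z` by the `n`-th ring. The clocks are rate one Poisson processes, the arrows are fair coins,
and all the clocks and all the arrows are jointly independent. -/
structure IsDrivenBy (N : EvenSite → ℝ≥0 → Ω → ℕ) (η : EvenSite → ℕ → Ω → Bool)
    (μ : Measure Ω) : Prop where
  /-- Every clock is a rate one Poisson process. -/
  clock : ∀ z, IsUnitPoissonProcess (N z) μ
  measurable_arrow : ∀ z n, Measurable (η z n)
  /-- Every arrow points right with probability `1/2`. -/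
  arrow_fair : ∀ z n, μ {ω | η z n ω = true} = 1 / 2
  /-- The arrows at a given site are independent. -/
  indep_arrows : ∀ z, iIndepFun (fun n => η z n) μ
  /-- At a given site the clock is independent of the sequence of arrows. -/
  indep_clock_arrows : ∀ z, IndepFun (fun ω τ => N z τ ω) (fun ω n => η z n ω) μ
  /-- The pairs (clock, sequence of arrows) at the different sites are independent. -/
  indep_sites : iIndepFun
    (fun z ω => ((fun τ => N z τ ω, fun n => η z n ω) : (ℝ≥0 → ℕ) × (ℕ → Bool))) μ

/-- The arrow configuration `ξ^τ` at dynamical time `τ`: at each site, the arrow that was put there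
by the last ring of its clock up to time `τ`, or the initial arrow if there was no ring. -/
def arrowsAt (N : EvenSite → ℝ≥0 → Ω → ℕ) (η : EvenSite → ℕ → Ω → Bool) (τ : ℝ≥0) (ω : Ω) :
    EvenSite → Bool :=
  fun z => η z (N z τ ω) ω

/-- The path `S_z^τ` of the dynamical discrete web at dynamical time `τ`. -/
noncomputable def path (N : EvenSite → ℝ≥0 → Ω → ℕ) (η : EvenSite → ℕ → Ω → Bool) (z : EvenSite)
    (τ : ℝ≥0) (ω : Ω) (t : ℝ) : ℝ :=
  webPath (arrowsAt N η τ ω) z t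

end DyDW

/-!
Fix a path time `n` and a sequence of `n` steps. The path from the origin taking these steps visits
`n` distinct sites. As the dynamical time runs through `[0, 1]`, the vector of ring counts at these
sites is non-decreasing in each coordinate, so it takes at most one more value than the total number
of rings, hence at most `n + 1` values on average (`IsDrivenBy.tsum_measure_counts_le`). For each
fixed vector of ring counts, the `n` arrows it selects are independent fair coins and independent
of the clocks. So with probability at most `(n + 1) / 2 ^ n` the path follows the given steps at
some dynamical time in `[0, 1]` (`IsDrivenBy.measure_exists_time_arrowsAt_eq_le`): the exceptional
times only cost a factor `n + 1`.

Summing over the step sequences that end beyond `a = 4 √(n log n)`, of which there are at most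
`2 ^ n exp (-a² / (2 n)) = 2 ^ n n⁻⁸` by Chernoff's bound (`card_steps_le`), gives a summable
bound, and the Borel-Cantelli lemma (`IsDrivenBy.ae_eventually_siteAfter_lt`) controls all
dynamical times in `[0, 1]` at once along integer path times. Interpolation adds at most `1`.
-/

/-! ### Poisson mean and independence of families -/

namespace ProbabilityTheory

lemma lintegral_natCast_poissonMeasure (r : ℝ≥0) :
    ∫⁻ k : ℕ, (k : ℝ≥0∞) ∂(poissonMeasure r) = r := by
  have hshift (n : ℕ) : ((n + 1 : ℕ) : ℝ≥0∞) * poissonMeasure r {n + 1}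
      = r * poissonMeasure r {n} := by
    rw [poissonMeasure_singleton, poissonMeasure_singleton, ← ENNReal.ofReal_natCast,
      ← ENNReal.ofReal_coe_nnreal, ← ENNReal.ofReal_mul (by positivity),
      ← ENNReal.ofReal_mul (by positivity)]
    congr 1
    rw [Nat.factorial_succ]
    push_cast
    field_simp
    ring
  rw [lintegral_countable', tsum_eq_zero_add' ENNReal.summable]
  simp_rw [hshift]
  rw [ENNReal.tsum_mul_left]
  have h1 : ∑' n : ℕ, poissonMeasure r {n} = 1 := by
    have := lintegral_countable' (μ := poissonMeasure r) (fun _ : ℕ => (1 : ℝ≥0∞))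
    simpa using this.symm
  simp [h1]

/-- If the pairs `(X i, Y i)` are independent and each `X i` is independent of `Y i`, then the
whole family `X` is independent of the whole family `Y`. -/
lemma iIndepFun.indepFun_pi_of_prodMk {Ω ι α β : Type*} [Fintype ι] [MeasurableSpace Ω]
    [MeasurableSpace α] [MeasurableSpace β] {μ : Measure Ω} [IsProbabilityMeasure μ]
    {X : ι → Ω → α} {Y : ι → Ω → β} (hX : ∀ i, Measurable (X i)) (hY : ∀ i, Measurable (Y i))
    (hXY : ∀ i, IndepFun (X i) (Y i) μ) (h : iIndepFun (fun i ω => (X i ω, Y i ω)) μ) :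
    IndepFun (fun ω i => X i ω) (fun ω i => Y i ω) μ := by
  have hXi (i : ι) : IsProbabilityMeasure (μ.map (X i)) :=
    Measure.isProbabilityMeasure_map (hX i).aemeasurable
  have hYi (i : ι) : IsProbabilityMeasure (μ.map (Y i)) :=
    Measure.isProbabilityMeasure_map (hY i).aemeasurable
  have hpair : μ.map (fun ω i => (X i ω, Y i ω))
      = Measure.pi fun i => (μ.map (X i)).prod (μ.map (Y i)) := by
    rw [h.map_fun_eq_pi_map fun i => ((hX i).prodMk (hY i)).aemeasurable]
    congr 1
    funext i
    exact (indepFun_iff_map_prod_eq_prod_map_map (hX i).aemeasurable (hY i).aemeasurable).1 (hXY i)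
  have hX' : iIndepFun X μ := h.comp (fun _ => Prod.fst) fun _ => measurable_fst
  have hY' : iIndepFun Y μ := h.comp (fun _ => Prod.snd) fun _ => measurable_snd
  rw [indepFun_iff_map_prod_eq_prod_map_map (by fun_prop) (by fun_prop),
    hX'.map_fun_eq_pi_map fun i => (hX i).aemeasurable,
    hY'.map_fun_eq_pi_map fun i => (hY i).aemeasurable,
    ← (measurePreserving_arrowProdEquivProdArrow α β ι _ _).map_eq, ← hpair,
    Measure.map_map (MeasurableEquiv.measurable _) (by fun_prop)]
  rfl

end ProbabilityTheory

/-! ### Monotone families of counts -/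

/-- A function of a linearly ordered time, monotone in each coordinate, takes at most `K + 1`
values in `ℕ^ι` whose coordinates add up to at most `K`: along its range the sum of the
coordinates is injective. -/
lemma encard_range_le_of_monotone_of_sum_le {ι T : Type*} [Fintype ι] [LinearOrder T]
    {f : T → ι → ℕ} (hf : Monotone f) {D : Set T} {K : ℕ} (hK : ∀ t ∈ D, ∑ i, f t i ≤ K) :
    (f '' D).encard ≤ K + 1 := by
  have hinj : Set.InjOn (fun m : ι → ℕ => ∑ i, m i) (f '' D) := by
    have key : ∀ s t, s ≤ t → ∑ i, f s i = ∑ i, f t i → f s = f t := by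
      intro s t hst heq
      funext i
      exact (Finset.sum_eq_sum_iff_of_le fun i _ => hf hst i).1 heq i (Finset.mem_univ i)
    rintro _ ⟨s, -, rfl⟩ _ ⟨t, -, rfl⟩ heq
    rcases le_total s t with hst | hts
    · exact key s t hst heq
    · exact (key t s hts heq.symm).symm
  rw [← hinj.encard_image]
  calc _ ≤ (Finset.range (K + 1) : Set ℕ).encard := by
        refine Set.encard_le_encard ?_
        rintro _ ⟨_, ⟨t, ht, rfl⟩, rfl⟩
        simpa [Nat.lt_succ_iff] using hK t ht
    _ = K + 1 := by rw [Set.encard_coe_eq_coe_finsetCard]; simp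

namespace DyDW

/-! ### Paths and their steps -/

lemma siteAfter_time (ξ : EvenSite → Bool) (z : EvenSite) (n : ℕ) :
    (siteAfter ξ z n).1.2 = z.1.2 + n := by
  induction n with
  | zero => simp [siteAfter]
  | succ n ih => simp only [siteAfter, arrowHead, ih]; push_cast; ring

lemma siteAfter_injective (ξ : EvenSite → Bool) (z : EvenSite) :
    Function.Injective (siteAfter ξ z) := by
  intro m n hmn
  have := congrArg (fun w : EvenSite => w.1.2) hmn
  simpa [siteAfter_time] using this

lemma siteAfter_space (ξ : EvenSite → Bool) (z : EvenSite) (n : ℕ) :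
    (siteAfter ξ z n).1.1 = z.1.1 + ∑ i ∈ Finset.range n, arrowSign (ξ (siteAfter ξ z i)) := by
  induction n with
  | zero => simp [siteAfter]
  | succ n ih => rw [Finset.sum_range_succ, ← add_assoc, ← ih]; rfl

lemma siteAfter_congr {ξ ζ : EvenSite → Bool} {z : EvenSite} {n : ℕ}
    (h : ∀ i < n, ξ (siteAfter ζ z i) = ζ (siteAfter ζ z i)) :
    siteAfter ξ z n = siteAfter ζ z n := by
  induction n with
  | zero => rfl
  | succ n ih =>
    have hn := ih fun i hi => h i (hi.trans n.lt_succ_self)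
    simp only [siteAfter, hn, h n n.lt_succ_self]

/-- The arrow configuration in which all the arrows at path time `i < n` have the direction `s i`,
so that every path starting at time `0` takes the steps `s`. The arrows at other times (`s 0` or
`false` at negative times, `false` from time `n` on) are irrelevant. -/
def stepArrows {n : ℕ} (s : Fin n → Bool) (z : EvenSite) : Bool :=
  if h : z.1.2.toNat < n then s ⟨z.1.2.toNat, h⟩ else false

lemma stepArrows_siteAfter {n : ℕ} (s : Fin n → Bool) (ξ : EvenSite → Bool) (i : Fin n) :
    stepArrows s (siteAfter ξ origin i) = s i := by
  have h : (siteAfter ξ origin i).1.2.toNat = i := by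
    rw [siteAfter_time]; simp [origin]
  simp [stepArrows, h]

/-- Any path from the origin agrees up to time `n` with the path taking its own first `n` steps. -/
lemma siteAfter_stepArrows (ξ : EvenSite → Bool) {n i : ℕ} (hi : i ≤ n) :
    siteAfter (stepArrows fun j : Fin n => ξ (siteAfter ξ origin j)) origin i
      = siteAfter ξ origin i :=
  siteAfter_congr fun j hj =>
    stepArrows_siteAfter (fun j : Fin n => ξ (siteAfter ξ origin j)) ξ ⟨j, hj.trans_le hi⟩

lemma webPath_origin_le (ξ : EvenSite → Bool) {t : ℝ} (ht : 0 ≤ t) :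
    webPath ξ origin t ≤ (siteAfter ξ origin ⌊t⌋₊).1.1 + 1 := by
  have h0 : (origin.1.2 : ℝ) = 0 := by simp [origin]
  simp only [webPath, h0, sub_zero]
  have h1 := Nat.floor_le ht
  have h2 := Nat.lt_floor_add_one t
  have h3 : (arrowSign (ξ (siteAfter ξ origin ⌊t⌋₊)) : ℝ) ≤ 1 := by
    cases ξ (siteAfter ξ origin ⌊t⌋₊) <;> norm_num [arrowSign]
  nlinarith

/-! ### Chernoff's bound for the simple random walk -/

lemma sum_exp_mul_sum_arrowSign (n : ℕ) (l : ℝ) :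
    ∑ s : Fin n → Bool, Real.exp (l * ∑ i, (arrowSign (s i) : ℝ)) = (2 * Real.cosh l) ^ n := by
  have h := Finset.prod_univ_sum (fun _ : Fin n => (Finset.univ : Finset Bool))
    (fun _ b => Real.exp (l * (arrowSign b : ℝ)))
  rw [Fintype.piFinset_univ] at h
  simp_rw [Finset.mul_sum, Real.exp_sum]
  rw [← h, Finset.prod_const, Finset.card_univ, Fintype.card_fin]
  congr 1
  simp [arrowSign, Real.cosh_eq]
  ring

open Classical in
/-- Chernoff's bound for the simple random walk, as a count of paths. -/
lemma card_steps_le {n : ℕ} (hn : 0 < n) {a : ℝ} (ha : 0 ≤ a) :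
    (({s | a ≤ ∑ i, (arrowSign (s i) : ℝ)} : Finset (Fin n → Bool)).card : ℝ)
      ≤ 2 ^ n * Real.exp (-(a ^ 2 / (2 * n))) := by
  have hn' : (0 : ℝ) < n := by exact_mod_cast hn
  -- `a / n` is the exponent for which the exponential Markov inequality is optimal.
  set l : ℝ := a / n with hl
  set F : Finset (Fin n → Bool) := {s | a ≤ ∑ i, (arrowSign (s i) : ℝ)} with hF
  have h1 : (F.card : ℝ) * Real.exp (l * a) ≤ (2 * Real.cosh l) ^ n := by
    rw [← sum_exp_mul_sum_arrowSign, ← nsmul_eq_mul]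
    refine (Finset.card_nsmul_le_sum F (fun s => Real.exp (l * ∑ i, (arrowSign (s i) : ℝ))) _
      fun s hs => ?_).trans
      (Finset.sum_le_univ_sum_of_nonneg fun s => (Real.exp_pos _).le)
    have hs' : a ≤ ∑ i, (arrowSign (s i) : ℝ) := by simpa [hF] using hs
    have : 0 ≤ l := by positivity
    gcongr
  have h2 : (2 * Real.cosh l) ^ n ≤ 2 ^ n * Real.exp (n * (l ^ 2 / 2)) := by
    rw [mul_pow, Real.exp_nat_mul]
    have := (Real.cosh_pos l).le
    gcongr
    exact Real.cosh_le_exp_half_sq l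
  have h3 : Real.exp (n * (l ^ 2 / 2)) = Real.exp (-(a ^ 2 / (2 * n))) * Real.exp (l * a) := by
    rw [← Real.exp_add]
    congr 1
    rw [hl]
    field_simp
    ring
  rw [h3, ← mul_assoc] at h2
  exact le_of_mul_le_mul_right (h1.trans h2) (Real.exp_pos _)

/-! ### Arrows seen during a unit of dynamical time -/

variable {Ω : Type*} [MeasurableSpace Ω] {μ : Measure Ω}

lemma IsUnitPoissonProcess.lintegral_one {N : ℝ≥0 → Ω → ℕ} (h : IsUnitPoissonProcess N μ) :
    ∫⁻ ω, (N 1 ω : ℝ≥0∞) ∂μ = 1 := by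
  have hlaw := h.law_increment 0 1 zero_le_one
  have h0 : ∫⁻ ω, (N 1 ω : ℝ≥0∞) ∂μ = ∫⁻ ω, ((N 1 ω - N 0 ω : ℕ) : ℝ≥0∞) ∂μ := by
    refine lintegral_congr_ae ?_
    filter_upwards [h.zero] with ω hω
    rw [hω, Nat.sub_zero]
  rw [h0, ← lintegral_map' (f := fun k : ℕ => (k : ℝ≥0∞)) (by fun_prop) hlaw.aemeasurable,
    hlaw.map_eq, lintegral_natCast_poissonMeasure]
  simp

variable {N : EvenSite → ℝ≥0 → Ω → ℕ} {η : EvenSite → ℕ → Ω → Bool}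

section Configurations

variable {ι : Type*} [Fintype ι] {z : ι → EvenSite}

lemma IsDrivenBy.measure_arrow_eq [IsProbabilityMeasure μ] (h : IsDrivenBy N η μ) (w : EvenSite)
    (n : ℕ) (b : Bool) : μ {ω | η w n ω = b} = 1 / 2 := by
  cases b with
  | true => exact h.arrow_fair w n
  | false =>
    have hmeas : MeasurableSet {ω | η w n ω = true} :=
      h.measurable_arrow w n (measurableSet_singleton true)
    have hcompl : {ω | η w n ω = false} = {ω | η w n ω = true}ᶜ := by ext; simp
    rw [hcompl, prob_compl_eq_one_sub hmeas, h.arrow_fair, one_div, ENNReal.one_sub_inv_two]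

lemma IsDrivenBy.measure_arrows_eq [IsProbabilityMeasure μ] (h : IsDrivenBy N η μ)
    (hz : Function.Injective z) (m : ι → ℕ) (b : ι → Bool) :
    μ {ω | ∀ i, η (z i) (m i) ω = b i} = (1 / 2) ^ Fintype.card ι := by
  have hind : iIndepFun (fun i => η (z i) (m i)) μ :=
    (h.indep_sites.precomp hz).comp (fun i p => p.2 (m i)) fun i => by fun_prop
  have h1 := hind.meas_iInter (s := fun i => {ω | η (z i) (m i) ω = b i})
    fun i => ⟨{b i}, measurableSet_singleton _, rfl⟩
  rw [Set.ofPred_forall, h1]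
  simp [h.measure_arrow_eq]

/-- The clocks at finitely many sites are jointly independent of the arrows at these sites. -/
lemma IsDrivenBy.indepFun_clocks_arrows [IsProbabilityMeasure μ] (h : IsDrivenBy N η μ)
    (hz : Function.Injective z) :
    IndepFun (fun ω i τ => N (z i) τ ω) (fun ω i n => η (z i) n ω) μ :=
  iIndepFun.indepFun_pi_of_prodMk (X := fun i ω τ => N (z i) τ ω) (Y := fun i ω n => η (z i) n ω)
    (fun i => measurable_pi_lambda _ (h.clock (z i)).measurable)
    (fun i => measurable_pi_lambda _ (h.measurable_arrow (z i)))
    (fun i => h.indep_clock_arrows (z i)) (h.indep_sites.precomp hz)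

/-- The expected number of vectors of ring counts at finitely many sites that are seen at times
`τ ∈ D ⊆ [0, 1]` is at most one plus the expected number of rings. -/
lemma IsDrivenBy.tsum_measure_counts_le (h : IsDrivenBy N η μ) [IsProbabilityMeasure μ]
    (z : ι → EvenSite) {D : Set ℝ≥0} (hD : D.Countable) (hD1 : ∀ q ∈ D, q ≤ 1) :
    ∑' m : ι → ℕ, μ {ω | ∃ q ∈ D, ∀ i, N (z i) q ω = m i} ≤ Fintype.card ι + 1 := by
  have hmeas (m : ι → ℕ) : MeasurableSet {ω | ∃ q ∈ D, ∀ i, N (z i) q ω = m i} := by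
    have : {ω | ∃ q ∈ D, ∀ i, N (z i) q ω = m i} = ⋃ q ∈ D, ⋂ i, N (z i) q ⁻¹' {m i} := by
      ext; simp
    rw [this]
    exact .biUnion hD fun q _ => .iInter fun i =>
      (h.clock (z i)).measurable q (measurableSet_singleton _)
  have hmono : ∀ᵐ ω ∂μ, ∀ i, Monotone fun t => N (z i) t ω :=
    ae_all_iff.2 fun i => (h.clock (z i)).monotone
  calc ∑' m : ι → ℕ, μ {ω | ∃ q ∈ D, ∀ i, N (z i) q ω = m i}
      = ∫⁻ ω, ∑' m : ι → ℕ, {ω | ∃ q ∈ D, ∀ i, N (z i) q ω = m i}.indicator 1 ω ∂μ := by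
        rw [lintegral_tsum fun m => (measurable_one.indicator (hmeas m)).aemeasurable]
        simp_rw [lintegral_indicator_one (hmeas _)]
    _ ≤ ∫⁻ ω, (∑ i, (N (z i) 1 ω : ℝ≥0∞)) + 1 ∂μ := by
        refine lintegral_mono_ae ?_
        filter_upwards [hmono] with ω hω
        have hbound := encard_range_le_of_monotone_of_sum_le (f := fun q i => N (z i) q ω)
          (fun s t hst i => hω i hst) (D := D) (K := ∑ i, N (z i) 1 ω)
          fun q hq => Finset.sum_le_sum fun i _ => hω i (hD1 q hq)
        have hset : ∑' m : ι → ℕ, {ω | ∃ q ∈ D, ∀ i, N (z i) q ω = m i}.indicator 1 ω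
            = (((fun q i => N (z i) q ω) '' D).encard : ℝ≥0∞) := by
          rw [← ENNReal.tsum_set_one, tsum_subtype (f := fun _ : ι → ℕ => (1 : ℝ≥0∞))]
          refine tsum_congr fun m => ?_
          have hiff : ω ∈ {ω | ∃ q ∈ D, ∀ i, N (z i) q ω = m i}
              ↔ m ∈ (fun q i => N (z i) q ω) '' D := by simp [funext_iff]
          by_cases hm : m ∈ (fun q i => N (z i) q ω) '' D
          · rw [Set.indicator_of_mem hm, Set.indicator_of_mem (hiff.2 hm), Pi.one_apply]
          · rw [Set.indicator_of_notMem hm, Set.indicator_of_notMem (mt hiff.1 hm)]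
        rw [hset]
        exact (ENat.toENNReal_le.2 hbound).trans_eq (by
          rw [ENat.toENNReal_add, ENat.toENNReal_coe, ENat.toENNReal_one, Nat.cast_sum])
    _ = Fintype.card ι + 1 := by
        rw [lintegral_add_right _ measurable_const, lintegral_finsetSum]
        · simp [(h.clock _).lintegral_one]
        · intro i _
          have := (h.clock (z i)).measurable 1
          fun_prop

/-- Whatever is seen at the sites `z i` at some time of `[0, 1]` is seen at a time of a fixed
countable set, by right-continuity of the clocks. The time `1` is kept because right-continuity
only reaches times after the given one. -/
lemma IsDrivenBy.exists_countable_times (h : IsDrivenBy N η μ) (z : ι → EvenSite) :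
    ∃ D : Set ℝ≥0, D.Countable ∧ (∀ q ∈ D, q ≤ 1) ∧
      ∀ᵐ ω ∂μ, ∀ τ ≤ (1 : ℝ≥0), ∃ q ∈ D, ∀ i, N (z i) q ω = N (z i) τ ω := by
  obtain ⟨D, hD, hdense⟩ := TopologicalSpace.exists_countable_dense ℝ≥0
  refine ⟨insert 1 (D ∩ Set.Iic 1), (hD.mono Set.inter_subset_left).insert 1, by simp, ?_⟩
  have hright : ∀ᵐ ω ∂μ, ∀ i, ∀ t, ContinuousWithinAt (fun s => N (z i) s ω) (Set.Ici t) t :=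
    ae_all_iff.2 fun i => (h.clock (z i)).rightContinuous
  filter_upwards [hright] with ω hω τ hτ
  rcases hτ.eq_or_lt with rfl | hlt
  · exact ⟨1, by simp, fun _ => rfl⟩
  have hev : ∀ᶠ q in 𝓝[>] τ, ∀ i, N (z i) q ω = N (z i) τ ω := by
    refine eventually_all.2 fun i => ?_
    have := (hω i τ).mono Set.Ioi_subset_Ici_self
    rw [ContinuousWithinAt, nhds_discrete, tendsto_pure] at this
    exact this
  obtain ⟨u, hu, hsub⟩ := mem_nhdsGT_iff_exists_Ioo_subset.1 hev
  obtain ⟨q, hqD, hq⟩ := hdense.exists_between (lt_min hu hlt)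
  exact ⟨q, .inr ⟨hqD, (hq.2.trans_le (min_le_right _ _)).le⟩,
    hsub ⟨hq.1, hq.2.trans_le (min_le_left _ _)⟩⟩

/-- Given arrows at `n` sites are all seen at a common time of `[0, 1]` with probability at most
`(n + 1) / 2 ^ n`: for a given vector of ring counts they have probability `1 / 2 ^ n`,
independently of the clocks, and on average at most `n + 1` vectors of ring counts occur. -/
lemma IsDrivenBy.measure_exists_time_arrowsAt_eq_le [IsProbabilityMeasure μ]
    (h : IsDrivenBy N η μ) (hz : Function.Injective z) (b : ι → Bool) :
    μ {ω | ∃ τ ∈ Set.Icc (0 : ℝ≥0) 1, ∀ i, arrowsAt N η τ ω (z i) = b i}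
      ≤ (Fintype.card ι + 1) * (1 / 2) ^ Fintype.card ι := by
  obtain ⟨D, hD, hD1, hae⟩ := h.exists_countable_times z
  set E : (ι → ℕ) → Set Ω := fun m => {ω | ∃ q ∈ D, ∀ i, N (z i) q ω = m i} with hE
  set A : (ι → ℕ) → Set Ω := fun m => {ω | ∀ i, η (z i) (m i) ω = b i} with hA
  have hind (m : ι → ℕ) : μ (E m ∩ A m) = μ (E m) * μ (A m) := by
    have hEm : MeasurableSet {f : ι → ℝ≥0 → ℕ | ∃ q ∈ D, ∀ i, f i q = m i} := by
      have : {f : ι → ℝ≥0 → ℕ | ∃ q ∈ D, ∀ i, f i q = m i}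
          = ⋃ q ∈ D, ⋂ i, (fun f : ι → ℝ≥0 → ℕ => f i q) ⁻¹' {m i} := by ext; simp
      rw [this]
      refine .biUnion hD fun q _ => .iInter fun i => ?_
      have hf : Measurable fun f : ι → ℝ≥0 → ℕ => f i q := by fun_prop
      exact hf (measurableSet_singleton _)
    have hAm : MeasurableSet {g : ι → ℕ → Bool | ∀ i, g i (m i) = b i} := by
      rw [Set.ofPred_forall]
      refine .iInter fun i => ?_
      have hg : Measurable fun g : ι → ℕ → Bool => g i (m i) := by fun_prop
      exact hg (measurableSet_singleton (b i))
    exact (h.indepFun_clocks_arrows hz).measure_inter_preimage_eq_mul _ _ hEm hAm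
  calc μ {ω | ∃ τ ∈ Set.Icc (0 : ℝ≥0) 1, ∀ i, arrowsAt N η τ ω (z i) = b i}
      ≤ μ (⋃ m, E m ∩ A m) := by
        refine measure_mono_ae ?_
        filter_upwards [hae] with ω hω hτ
        obtain ⟨τ, hτ, hb⟩ := hτ
        exact Set.mem_iUnion.2 ⟨fun i => N (z i) τ ω, hω τ hτ.2, hb⟩
    _ ≤ ∑' m, μ (E m ∩ A m) := measure_iUnion_le _
    _ = (∑' m, μ (E m)) * (1 / 2) ^ Fintype.card ι := by
        rw [← ENNReal.tsum_mul_right]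
        refine tsum_congr fun m => ?_
        rw [hind, h.measure_arrows_eq hz]
    _ ≤ _ := by
        gcongr
        exact h.tsum_measure_counts_le z hD hD1

end Configurations

/-! ### Growth of the paths, uniformly in the dynamical time -/

/-- A union bound over the sequences of `n` steps. -/
lemma IsDrivenBy.measure_exists_time_siteAfter_ge_le [IsProbabilityMeasure μ]
    (h : IsDrivenBy N η μ) {n : ℕ} (hn : 0 < n) {a : ℝ} (ha : 0 ≤ a) :
    μ {ω | ∃ τ ∈ Set.Icc (0 : ℝ≥0) 1, a ≤ (siteAfter (arrowsAt N η τ ω) origin n).1.1}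
      ≤ ENNReal.ofReal ((n + 1) * Real.exp (-(a ^ 2 / (2 * n)))) := by
  classical
  set F : Finset (Fin n → Bool) := {s | a ≤ ∑ i, (arrowSign (s i) : ℝ)} with hF
  calc μ {ω | ∃ τ ∈ Set.Icc (0 : ℝ≥0) 1, a ≤ (siteAfter (arrowsAt N η τ ω) origin n).1.1}
      ≤ μ (⋃ s ∈ F, {ω | ∃ τ ∈ Set.Icc (0 : ℝ≥0) 1, ∀ i : Fin n,
          arrowsAt N η τ ω (siteAfter (stepArrows s) origin i) = s i}) := by
        refine measure_mono ?_
        rintro ω ⟨τ, hτ, hle⟩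
        simp only [Set.mem_iUnion]
        refine ⟨fun i : Fin n => arrowsAt N η τ ω (siteAfter (arrowsAt N η τ ω) origin i), ?_,
          τ, hτ, fun i => ?_⟩
        · simp only [hF, Finset.mem_filter, Finset.mem_univ, true_and]
          rw [siteAfter_space, ← Fin.sum_univ_eq_sum_range
            fun i => arrowSign (arrowsAt N η τ ω (siteAfter (arrowsAt N η τ ω) origin i))] at hle
          simpa [origin] using hle
        · rw [siteAfter_stepArrows _ i.2.le]
    _ ≤ ∑ s ∈ F, ((n : ℝ≥0∞) + 1) * (1 / 2) ^ n := by
        refine (measure_biUnion_finset_le _ _).trans (Finset.sum_le_sum fun s _ => ?_)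
        have hz : Function.Injective fun i : Fin n => siteAfter (stepArrows s) origin i :=
          (siteAfter_injective _ _).comp Fin.val_injective
        simpa using h.measure_exists_time_arrowsAt_eq_le hz s
    _ = ENNReal.ofReal (F.card * ((n + 1) * (1 / 2) ^ n)) := by
        rw [Finset.sum_const, nsmul_eq_mul, ENNReal.ofReal_mul (by positivity),
          ENNReal.ofReal_mul (by positivity), ENNReal.ofReal_pow (by positivity),
          ENNReal.ofReal_add (by positivity) zero_le_one, ENNReal.ofReal_natCast,
          ENNReal.ofReal_natCast, ENNReal.ofReal_one, one_div, one_div,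
          ENNReal.ofReal_inv_of_pos two_pos, ENNReal.ofReal_ofNat]
    _ ≤ _ := by
        refine ENNReal.ofReal_le_ofReal ?_
        have hcard := card_steps_le hn ha
        calc (F.card : ℝ) * ((n + 1) * (1 / 2) ^ n)
            ≤ (2 ^ n * Real.exp (-(a ^ 2 / (2 * n)))) * ((n + 1) * (1 / 2) ^ n) := by
              gcongr
          _ = (n + 1) * Real.exp (-(a ^ 2 / (2 * n))) * (2 * (1 / 2)) ^ n := by
              rw [mul_pow]; ring
          _ = _ := by norm_num

/-- Almost surely, for large `n`, no path from the origin at a time of `[0, 1]` is beyond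
`4 √(n log n)` at path time `n`. -/
lemma IsDrivenBy.ae_eventually_siteAfter_lt [IsProbabilityMeasure μ] (h : IsDrivenBy N η μ) :
    ∀ᵐ ω ∂μ, ∀ᶠ n : ℕ in atTop, ∀ τ ∈ Set.Icc (0 : ℝ≥0) 1,
      ((siteAfter (arrowsAt N η τ ω) origin n).1.1 : ℝ) < 4 * √(n * Real.log n) := by
  set B : ℕ → Set Ω := fun n => {ω | ∃ τ ∈ Set.Icc (0 : ℝ≥0) 1,
    4 * √(n * Real.log n) ≤ (siteAfter (arrowsAt N η τ ω) origin n).1.1} with hB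
  have hbound (n : ℕ) (hn : 0 < n) : μ (B n) ≤ ENNReal.ofReal (2 * (1 / (n : ℝ) ^ 2)) := by
    refine (h.measure_exists_time_siteAfter_ge_le hn (by positivity)).trans
      (ENNReal.ofReal_le_ofReal ?_)
    have hn1 : (1 : ℝ) ≤ n := by exact_mod_cast hn
    have hlog := Real.log_nonneg hn1
    -- With `a = c √(n log n)` the exponent is `c² / 2`; `c = 4` leaves room for the factor `n + 1`.
    have hexp : Real.exp (-((4 * √(n * Real.log n)) ^ 2 / (2 * n))) = 1 / (n : ℝ) ^ 8 := by
      have h8 : -((4 * √(n * Real.log n)) ^ 2 / (2 * n)) = -((8 : ℕ) * Real.log n) := by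
        rw [mul_pow, Real.sq_sqrt (by positivity)]
        field_simp
        ring
      rw [h8, Real.exp_neg, Real.exp_nat_mul, Real.exp_log (by positivity), one_div]
    rw [hexp]
    have h3 : (n : ℝ) ^ 3 ≤ (n : ℝ) ^ 8 := pow_le_pow_right₀ hn1 (by norm_num)
    calc ((n : ℝ) + 1) * (1 / (n : ℝ) ^ 8) ≤ (2 * n) * (1 / (n : ℝ) ^ 3) := by
          gcongr
          linarith
      _ = 2 * (1 / (n : ℝ) ^ 2) := by field_simp
  have hsum : ∑' n, μ (B (n + 1)) ≠ ∞ := by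
    have hs : Summable fun n : ℕ => 2 * (1 / ((n + 1 : ℕ) : ℝ) ^ 2) :=
      ((summable_nat_add_iff 1).2 (Real.summable_one_div_nat_pow.2 one_lt_two)).mul_left 2
    refine ne_top_of_le_ne_top hs.tsum_ofReal_ne_top (ENNReal.tsum_le_tsum fun n => ?_)
    exact hbound (n + 1) n.succ_pos
  filter_upwards [ae_eventually_notMem hsum] with ω hω
  rw [← map_add_atTop_eq_nat 1, eventually_map]
  filter_upwards [hω] with n hn τ hτ
  by_contra! hle
  exact hn ⟨τ, hτ, hle⟩

lemma limsup_webPath_div_le {ξ : EvenSite → Bool}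
    (h : ∀ᶠ n : ℕ in atTop, ((siteAfter ξ origin n).1.1 : ℝ) < 4 * √(n * Real.log n)) :
    limsup (fun t : ℝ => ((webPath ξ origin t / √(t * Real.log t) : ℝ) : EReal)) atTop
      ≤ ((5 : ℝ) : EReal) := by
  refine limsup_le_of_le (h := ?_)
  filter_upwards [(tendsto_nat_floor_atTop (α := ℝ)).eventually h,
    eventually_ge_atTop (Real.exp 1)] with t ht hte
  have h1t : 1 ≤ t := le_trans (by simp) hte
  have hlog : 1 ≤ Real.log t := (Real.le_log_iff_exp_le (by positivity)).2 hte
  have hfloor : (⌊t⌋₊ : ℝ) ≤ t := Nat.floor_le (by positivity)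
  have hfloor1 : (1 : ℝ) ≤ ⌊t⌋₊ := by exact_mod_cast (Nat.one_le_floor_iff t).2 h1t
  have hsqrt : √(⌊t⌋₊ * Real.log ⌊t⌋₊) ≤ √(t * Real.log t) := by
    have := Real.log_nonneg hfloor1
    gcongr
  have hone : 1 ≤ √(t * Real.log t) := Real.one_le_sqrt.2 (one_le_mul_of_one_le_of_one_le h1t hlog)
  have hpath := webPath_origin_le ξ (zero_le_one.trans h1t)
  rw [EReal.coe_le_coe_iff, div_le_iff₀ (by positivity)]
  linarith

end DyDW

theorem theorem3 :
    ∃ C₀ : ℝ, 0 < C₀ ∧ ∀ C : ℝ, C₀ ≤ C →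
      ∀ {Ω : Type*} [MeasurableSpace Ω] (μ : Measure Ω) [IsProbabilityMeasure μ]
        (N : DyDW.EvenSite → ℝ≥0 → Ω → ℕ) (η : DyDW.EvenSite → ℕ → Ω → Bool),
        DyDW.IsDrivenBy N η μ →
        μ {ω | ∃ τ : ℝ≥0, τ ∈ Set.Icc 0 1 ∧
          (C : EReal) ≤ limsup
            (fun t : ℝ => ((DyDW.path N η DyDW.origin τ ω t / √(t * Real.log t) : ℝ) : EReal))
            atTop} = 0 := by
  refine ⟨6, by norm_num, fun C hC Ω _ μ _ N η h => ?_⟩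
  have hae : ∀ᵐ ω ∂μ, ¬ ∃ τ : ℝ≥0, τ ∈ Set.Icc 0 1 ∧ (C : EReal) ≤ limsup
      (fun t : ℝ => ((DyDW.path N η DyDW.origin τ ω t / √(t * Real.log t) : ℝ) : EReal))
      atTop := by
    filter_upwards [h.ae_eventually_siteAfter_lt] with ω hω
    rintro ⟨τ, hτ, hle⟩
    have hlim := hle.trans (DyDW.limsup_webPath_div_le (hω.mono fun n hn => hn τ hτ))
    rw [EReal.coe_le_coe_iff] at hlim
    linarith
  simpa [ae_iff] using hae
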